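/- Let $\mathcal H$ be a complex Hilbert space and let $\mathcal R\subseteq\mathcal L(\mathcal H)$ be a von Neumann algebra that is a factor of type $I_n$, $n\in\{3,4,\dots\}\cup\{\infty\}$; that is, the centre of $\mathcal R$ is $\mathbb C I$, and the identity $I$ is the sum (in the strong operator topology) of $n$ pairwise orthogonal, pairwise Murray–von Neumann equivalent abelian projections of $\mathcal R$. If $n=\infty$, assume that $\mathcal H$ is separable. Then there is no valuation function on $\mathcal R$, i.e. there is no map $v:\mathcal R_{sa}\to\mathbb R$ on the self-adjoint elements of $\mathcal R$ such that (a) $v(A)\in\operatorname{sp}A$ for every $A\in\mathcal R_{sa}$, and (b) $v(f(A))=f(v(A))$ for every $A\in\mathcal R_{sa}$ and every Borel function $f:\mathbb R\to\mathbb R$ for which $f(A)$, defined by the Borel functional calculus, is a bounded operator. -/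

import Mathlib

open MeasureTheory
open scoped InnerProductSpace BoundedContinuousFunction

section SpectralCalculus

variable {H : Type*} [NormedAddCommGroup H] [InnerProductSpace ℂ H] [CompleteSpace H]

/-- `μ` is the (scalar) spectral measure of the self-adjoint operator `A` at the vector `x`: the
finite Borel measure on `ℝ` such that `⟪x, g(A) x⟫ = ∫ g dμ` for every bounded continuous function
`g : ℝ → ℝ`, where `g(A)` is given by the continuous functional calculus. By the Riesz
representation theorem there is exactly one such measure. -/
structure IsSpectralMeasureAt (A : H →L[ℂ] H) (x : H) (μ : Measure ℝ) : Prop where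
  isFiniteMeasure : IsFiniteMeasure μ
  inner_cfc : ∀ g : ℝ →ᵇ ℝ, ⟪x, cfc (g : ℝ → ℝ) A x⟫_ℂ = ((∫ t, g t ∂μ : ℝ) : ℂ)

/-- `B = f(A)` in the sense of the Borel functional calculus, for a self-adjoint bounded operator
`A`, a Borel function `f : ℝ → ℝ` and a bounded operator `B`: for every vector `x`, the function
`f` is integrable for the spectral measure `μ_x` of `A` at `x` and `⟪x, B x⟫ = ∫ f dμ_x`.
At most one `B` has this property, and one exists exactly if `f` is essentially bounded on the
spectrum of `A`, that is, if `f(A)` is a bounded operator. -/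
def IsBorelFunctionOf (A : H →L[ℂ] H) (f : ℝ → ℝ) (B : H →L[ℂ] H) : Prop :=
  ∀ x : H, ∃ μ : Measure ℝ, IsSpectralMeasureAt A x μ ∧ Integrable f μ ∧
    ⟪x, B x⟫_ℂ = ((∫ t, f t ∂μ : ℝ) : ℂ)

end SpectralCalculus

namespace VonNeumannAlgebra

variable {H : Type*} [NormedAddCommGroup H] [InnerProductSpace ℂ H] [CompleteSpace H]

/-- The set of self-adjoint elements of a von Neumann algebra. -/
def selfAdjointPart (R : VonNeumannAlgebra H) : Set (H →L[ℂ] H) :=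
  {A | A ∈ R ∧ IsSelfAdjoint A}

/-- A factor: a von Neumann algebra whose centre consists of the scalar multiples of `1`. -/
def IsFactor (R : VonNeumannAlgebra H) : Prop :=
  ∀ T ∈ R, T ∈ R.commutant → ∃ c : ℂ, T = c • (1 : H →L[ℂ] H)

/-- An abelian projection of `R`: a projection `E ∈ R` such that `E R E` is commutative. -/
def IsAbelianProjection (R : VonNeumannAlgebra H) (E : H →L[ℂ] H) : Prop :=
  E ∈ R ∧ IsStarProjection E ∧ ∀ S ∈ R, ∀ T ∈ R, Commute (E * S * E) (E * T * E)

/-- Murray–von Neumann equivalence of `E` and `F` relative to `R`. -/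
def IsEquivalent (R : VonNeumannAlgebra H) (E F : H →L[ℂ] H) : Prop :=
  ∃ V ∈ R, star V * V = E ∧ V * star V = F

/-- `R` is of type `I_n`, for `n` a natural number or `∞`: the identity is the sum, in the strong
operator topology, of `n` pairwise orthogonal, pairwise equivalent abelian projections of `R`. -/
def IsTypeI (R : VonNeumannAlgebra H) (n : ℕ∞) : Prop :=
  ∃ P : Set (H →L[ℂ] H), P.encard = n ∧
    (∀ E ∈ P, R.IsAbelianProjection E) ∧
    (∀ E ∈ P, ∀ F ∈ P, E ≠ F → E * F = 0) ∧
    (∀ E ∈ P, ∀ F ∈ P, R.IsEquivalent E F) ∧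
    ∀ x : H, HasSum (fun E : P => (E : H →L[ℂ] H) x) x

/-- A valuation function on the self-adjoint part of `R`: it satisfies the spectrum rule
`v(A) ∈ sp A` and the FUNC principle `v(f(A)) = f(v(A))` for all Borel functions `f : ℝ → ℝ`
(for which `f(A)` is bounded, so that it is again a self-adjoint element of `R`). -/
structure IsValuationFunction (R : VonNeumannAlgebra H) (v : R.selfAdjointPart → ℝ) : Prop where
  mem_spectrum : ∀ A : R.selfAdjointPart, ((v A : ℝ) : ℂ) ∈ spectrum ℂ (A : H →L[ℂ] H)
  func : ∀ (A B : R.selfAdjointPart) (f : ℝ → ℝ), Measurable f →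
    IsBorelFunctionOf (A : H →L[ℂ] H) f (B : H →L[ℂ] H) → v B = f (v A)

end VonNeumannAlgebra

/-!
A valuation gives every projection of `R` the value `0` or `1`, and the proof shows that these
truth values would violate the Kochen–Specker theorem.

Let `E i` be countably many projections of `R` with sum `1`. With distinct summable reals `a i`, the
operator `A = ∑ a i • E i` lies in `R`, its spectral measure at `x` is `∑ ‖E i x‖² δ_{a i}`, and each
`E i` is the indicator function of `{a i}` applied to `A`. Hence exactly one `E i` is true
(`VonNeumannAlgebra.IsValuationFunction.existsUnique_isTrue`). That the value of `A` is one of the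
`a i`, and not merely in their closure, uses a Borel indicator function as well.

A type `I_n` decomposition of `1` is countable, by separability if `n = ∞`, so it has a true member
`E₀`. Choose two further members `E₁` and `E₂`. Equivalence provides partial isometries
`Vᵢ : E₀ → Eᵢ` in `R`, and the matrix units `Vᵢ Vⱼ*` embed the real `3 × 3` matrices into `R`, with
unit `E₀ + E₁ + E₂` (`matrixUnitSum`). The images of the projections onto the lines of `ℝ³` are
then coloured true and false so that orthogonal lines are not both true and every orthogonal triple
of lines contains a true one, because its sum is that of the `Eᵢ`, among which `E₀` is true.

Such a colouring is impossible (`not_isFrameColoring`): truth of a vector is inherited by vectors at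
an angle of tangent at most `1/2` (`IsFrameColoring.rotate`), and as
`arctan (1/2) + arctan (1/3) = π/4`, truth of `e₁` passes to both of the orthogonal vectors
`(1, 1, 0)` and `(1, -1, 0)`.
-/

/-! ### The Kochen–Specker theorem in three dimensions -/

section KochenSpecker

open Matrix

/-- A truth assignment to the nonzero vectors of `ℝ³`: orthogonal nonzero vectors are never both
true, and every orthogonal basis contains a true vector. The value at `0` is immaterial. -/
structure IsFrameColoring (c : (Fin 3 → ℝ) → Prop) : Prop where
  not_both : ∀ u w, u ≠ 0 → w ≠ 0 → u ⬝ᵥ w = 0 → c u → ¬ c w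
  exists_true : ∀ u v w, u ≠ 0 → v ≠ 0 → w ≠ 0 → u ⬝ᵥ v = 0 → u ⬝ᵥ w = 0 → v ⬝ᵥ w = 0 →
    c u ∨ c v ∨ c w

namespace IsFrameColoring

variable {c : (Fin 3 → ℝ) → Prop}

lemma comp_mulVec (hc : IsFrameColoring c) {M : Matrix (Fin 3) (Fin 3) ℝ} {r : ℝ} (hr : r ≠ 0)
    (hM : Mᵀ * M = r • 1) : IsFrameColoring fun u => c (M *ᵥ u) := by
  have key : ∀ u w, (M *ᵥ u) ⬝ᵥ (M *ᵥ w) = r * (u ⬝ᵥ w) := fun u w => by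
    rw [← Matrix.vecMul_transpose, ← Matrix.dotProduct_mulVec, Matrix.mulVec_mulVec, hM,
      Matrix.smul_mulVec, Matrix.one_mulVec, dotProduct_smul, smul_eq_mul]
  have hne : ∀ u, u ≠ 0 → M *ᵥ u ≠ 0 := fun u hu h => by
    have := key u u
    rw [h, zero_dotProduct, eq_comm, mul_eq_zero, dotProduct_self_eq_zero] at this
    exact this.elim hr hu
  have horth : ∀ u w, u ⬝ᵥ w = 0 → (M *ᵥ u) ⬝ᵥ (M *ᵥ w) = 0 := fun u w h => by
    rw [key, h, mul_zero]
  exact ⟨fun u w hu hw h => hc.not_both _ _ (hne u hu) (hne w hw) (horth u w h),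
    fun u v w hu hv hw h₁ h₂ h₃ => hc.exists_true _ _ _ (hne u hu) (hne v hv) (hne w hw)
      (horth _ _ h₁) (horth _ _ h₂) (horth _ _ h₃)⟩

/-- If `e₁` is true then so is every `e₁ + t e₂` with `t² = ε - ε²`, which is solvable in `ε`
exactly for `|t| ≤ 1/2`. Otherwise `(t, -1, 0)` is true, as `e₃` is false; the vectors
`(1, t, ±ε)` are orthogonal to it and `(0, ε, ∓t)` are orthogonal to `e₁`, so all four are false.
They span two planes with the normals `(-ε, t, ε)` and `(ε, -t, ε)`, which are therefore true.
The basis `(1, 0, 1), (1, 0, -1), e₂` is then false throughout. -/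
lemma rotate (hc : IsFrameColoring c) (h : c ![1, 0, 0]) {t ε : ℝ} (hε : ε ≠ 0)
    (ht : t ^ 2 = ε - ε ^ 2) : c ![1, t, 0] := by
  by_contra hn
  have h₃ : ¬ c ![0, 0, 1] := hc.not_both _ _ (by simp) (by simp) (by simp) h
  have h₂ : ¬ c ![0, 1, 0] := hc.not_both _ _ (by simp) (by simp) (by simp) h
  have hs : c ![t, -1, 0] := by
    have := hc.exists_true ![1, t, 0] ![0, 0, 1] ![t, -1, 0] (by simp) (by simp) (by simp)
      (by simp) (by simp) (by simp)
    tauto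
  have hq : ∀ δ, ¬ c ![1, t, δ] := fun δ =>
    hc.not_both _ _ (by simp) (by simp) (by simp) hs
  have hr : ∀ δ, ¬ c ![0, ε, δ] := fun δ =>
    hc.not_both _ _ (by simp) (by simp [hε]) (by simp) h
  have hp : c ![-ε, t, ε] := by
    have := hc.exists_true ![1, t, ε] ![0, ε, -t] ![-ε, t, ε] (by simp) (by simp [hε])
      (by simp [hε]) (by simp; ring)
      (by simp; linarith) (by simp; ring)
    have := hq ε
    have := hr (-t)
    tauto
  have hm : c ![ε, -t, ε] := by
    have := hc.exists_true ![1, t, -ε] ![0, ε, t] ![ε, -t, ε] (by simp) (by simp [hε])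
      (by simp [hε]) (by simp; ring)
      (by simp; linarith) (by simp; ring)
    have := hq (-ε)
    have := hr t
    tauto
  have h₄ : ¬ c ![1, 0, 1] := hc.not_both _ _ (by simp [hε]) (by simp) (by simp) hp
  have h₅ : ¬ c ![1, 0, -1] := hc.not_both _ _ (by simp [hε]) (by simp) (by simp) hm
  have := hc.exists_true ![1, 0, 1] ![1, 0, -1] ![0, 1, 0] (by simp) (by simp) (by simp)
    (by simp) (by simp) (by simp)
  tauto

/-- Two rotations, by `arctan (1/2)` and `arctan (1/3)`, add up to a rotation by `π/4`; in either
direction (`s = ±1`) they carry truth from `e₁` to the diagonal. -/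
lemma diagonal (hc : IsFrameColoring c) (h : c ![1, 0, 0]) {s : ℝ} (hs : s ^ 2 = 1) :
    c ![5 / 6, s * (5 / 6), 0] := by
  have h5 : √5 ^ 2 = 5 := Real.sq_sqrt (by norm_num)
  have h₁ : c ![1, s / 2, 0] := hc.rotate h (ε := 1 / 2) (by norm_num)
    (by linear_combination hs / 4)
  -- The orthogonal frame `(1, s/2, 0), (-s/2, 1, 0), (0, 0, √5/2)` of vectors of equal length.
  let M : Matrix (Fin 3) (Fin 3) ℝ := !![1, -s / 2, 0; s / 2, 1, 0; 0, 0, √5 / 2]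
  have hM : Mᵀ * M = (5 / 4 : ℝ) • (1 : Matrix (Fin 3) (Fin 3) ℝ) := by
    ext i j
    fin_cases i <;> fin_cases j <;>
      simp [M, Matrix.mul_apply, Fin.sum_univ_three] <;> nlinarith
  -- `ε` is a root of `ε - ε² = (1/3)²`.
  have := (hc.comp_mulVec (by norm_num) hM).rotate (t := s / 3) (ε := 1 / 2 + √5 / 6) ?_
    (by positivity) (by linear_combination hs / 9 + h5 / 36)
  · convert this using 1
    ext i
    fin_cases i <;> simp [M, Matrix.mulVec, dotProduct, Fin.sum_univ_three] <;> linarith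
  · convert h₁ using 1
    ext i
    fin_cases i <;> simp [M, Matrix.mulVec, dotProduct, Fin.sum_univ_three]

lemma not_true_e₁ (hc : IsFrameColoring c) : ¬ c ![1, 0, 0] := fun h =>
  hc.not_both _ _ (by simp) (by simp) (by simp)
    (hc.diagonal h (s := 1) (by norm_num)) (hc.diagonal h (s := -1) (by norm_num))

end IsFrameColoring

/-- **Kochen–Specker theorem** for `ℝ³`. -/
theorem not_isFrameColoring (c : (Fin 3 → ℝ) → Prop) : ¬ IsFrameColoring c := fun hc => by
  -- The cyclic permutation `e₁ ↦ e₂ ↦ e₃ ↦ e₁` moves each basis vector to the position of `e₁`.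
  let M : Matrix (Fin 3) (Fin 3) ℝ := !![0, 0, 1; 1, 0, 0; 0, 1, 0]
  have hM : Mᵀ * M = (1 : ℝ) • (1 : Matrix (Fin 3) (Fin 3) ℝ) := by
    ext i j
    fin_cases i <;> fin_cases j <;> simp [M, Matrix.mul_apply, Fin.sum_univ_three]
  have hc₂ := hc.comp_mulVec one_ne_zero hM
  have h₁ := hc.not_true_e₁
  have h₂ := hc₂.not_true_e₁
  have h₃ := (hc₂.comp_mulVec one_ne_zero hM).not_true_e₁
  have e₂ : M *ᵥ ![1, 0, 0] = ![0, 1, 0] := by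
    ext i; fin_cases i <;> simp [M, Matrix.mulVec, dotProduct, Fin.sum_univ_three]
  have e₃ : M *ᵥ ![0, 1, 0] = ![0, 0, 1] := by
    ext i; fin_cases i <;> simp [M, Matrix.mulVec, dotProduct, Fin.sum_univ_three]
  simp only [e₂, e₃] at h₂ h₃
  have := hc.exists_true ![1, 0, 0] ![0, 1, 0] ![0, 0, 1] (by simp) (by simp) (by simp)
    (by simp) (by simp) (by simp)
  tauto

end KochenSpecker

/-! ### Borel functions of a diagonal operator -/

section Diagonal

variable {H : Type*} [NormedAddCommGroup H] [InnerProductSpace ℂ H] [CompleteSpace H]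

lemma cfc_apply_of_apply_eq_smul {A : H →L[ℂ] H} (hA : IsSelfAdjoint A) {g : ℝ → ℝ}
    (hg : Continuous g) {x : H} {a : ℝ} (hx : A x = a • x) : cfc g A x = g a • x := by
  -- Polynomials satisfy this; approximate `g` by them uniformly on an interval that contains the
  -- spectrum and `a` (which may lie outside the spectrum if `x = 0`).
  have hpoly : ∀ p : Polynomial ℝ, cfc p.eval A x = p.eval a • x := fun p => by
    rw [cfc_polynomial p A hA]
    induction p using Polynomial.induction_on' with
    | add p q hp hq => simp [hp, hq, add_smul]
    | monomial n r =>
      have : ∀ k : ℕ, (A ^ k) x = a ^ k • x := fun k => by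
        induction k with
        | zero => simp
        | succ k ih =>
          rw [pow_succ, mul_apply_eq_comp, hx, ContinuousLinearMap.map_smul_of_tower, ih, smul_smul,
            pow_succ']
      simp [Polynomial.aeval_monomial, this, mul_smul, Algebra.algebraMap_eq_smul_one]
  set C := max ‖A‖ |a| with hC
  refine eq_of_forall_dist_le fun δ hδ => ?_
  obtain ⟨η, hη, hηδ⟩ : ∃ η > 0, 2 * η * ‖x‖ ≤ δ := by
    refine ⟨δ / (2 * (‖x‖ + 1)), by positivity, ?_⟩
    have : 2 * (δ / (2 * (‖x‖ + 1))) * ‖x‖ = δ * (‖x‖ / (‖x‖ + 1)) := by field_simp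
    rw [this]
    exact mul_le_of_le_one_right hδ.le ((div_le_one (by positivity)).2 (by linarith))
  obtain ⟨p, hp⟩ := exists_polynomial_near_of_continuousOn (-C) C g hg.continuousOn η hη
  have hnorm : ‖cfc g A - cfc p.eval A‖ ≤ η := by
    rw [← cfc_sub g p.eval A hg.continuousOn p.continuous.continuousOn]
    refine norm_cfc_le hη.le fun t ht => ?_
    rw [Real.norm_eq_abs, abs_sub_comm]
    refine (hp t ?_).le
    have h1 : ‖t‖ ≤ ‖A‖ := by
      have := spectrum.norm_le_norm_mul_of_mem ht
      refine this.trans (mul_le_of_le_one_right (norm_nonneg _) ?_)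
      exact ContinuousLinearMap.norm_id_le
    exact abs_le.1 (h1.trans (le_max_left _ _))
  have ha : |p.eval a - g a| < η := hp a (abs_le.1 (le_max_right _ _))
  calc dist (cfc g A x) (g a • x)
      = ‖(cfc g A - cfc p.eval A) x + (p.eval a - g a) • x‖ := by
        rw [dist_eq_norm]
        congr 1
        rw [sub_apply, hpoly, sub_smul]
        abel
    _ ≤ ‖cfc g A - cfc p.eval A‖ * ‖x‖ + |p.eval a - g a| * ‖x‖ := by
        refine (norm_add_le _ _).trans (add_le_add (ContinuousLinearMap.le_opNorm _ _) ?_)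
        rw [norm_smul, Real.norm_eq_abs]
    _ ≤ η * ‖x‖ + η * ‖x‖ := by gcongr
    _ ≤ δ := by linarith

/-- A (strong operator) resolution of the identity into projections `E i`. -/
structure IsProjectionResolution {ι : Type*} (E : ι → H →L[ℂ] H) : Prop where
  isStarProjection : ∀ i, IsStarProjection (E i)
  mul_eq_zero : ∀ i j, i ≠ j → E i * E j = 0
  hasSum : ∀ x, HasSum (fun i => E i x) x

namespace IsProjectionResolution

variable {ι : Type*} {E : ι → H →L[ℂ] H}

lemma inner_apply_eq (hE : IsProjectionResolution E) (i : ι) (x : H) :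
    ⟪x, E i x⟫_ℂ = ((‖E i x‖ ^ 2 : ℝ) : ℂ) := by
  have hi := hE.isStarProjection i
  have : E i x = (star (E i)) (E i x) := by
    rw [hi.isSelfAdjoint.star_eq, ← mul_apply_eq_comp, hi.isIdempotentElem.eq]
  rw [this, ContinuousLinearMap.star_eq_adjoint, ContinuousLinearMap.adjoint_inner_right,
    inner_self_eq_norm_sq_to_K, ← ContinuousLinearMap.star_eq_adjoint, ← this]
  simp

lemma hasSum_norm_sq (hE : IsProjectionResolution E) (x : H) :
    HasSum (fun i => ‖E i x‖ ^ 2) (‖x‖ ^ 2) := by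
  have h := (hE.hasSum x).mapL (innerSL ℂ x)
  simp only [innerSL_apply_apply, hE.inner_apply_eq, inner_self_eq_norm_sq_to_K] at h
  rw [← Complex.hasSum_ofReal]
  simpa using h

/-- The measure `∑ i, ‖E i x‖² δ_{a i}`, which is the spectral measure at `x` of the operator with
the eigenprojections `E i` and the eigenvalues `a i`. -/
noncomputable def diagMeasure (E : ι → H →L[ℂ] H) (a : ι → ℝ) (x : H) : Measure ℝ :=
  Measure.sum fun i => ENNReal.ofReal (‖E i x‖ ^ 2) • Measure.dirac (a i)

lemma isFiniteMeasure_diagMeasure (hE : IsProjectionResolution E) (a : ι → ℝ) (x : H) :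
    IsFiniteMeasure (diagMeasure E a x) := by
  refine ⟨?_⟩
  rw [diagMeasure, Measure.sum_apply _ MeasurableSet.univ]
  simp only [Measure.smul_apply, measure_univ, smul_eq_mul, mul_one]
  rw [← ENNReal.ofReal_tsum_of_nonneg (fun _ => by positivity) (hE.hasSum_norm_sq x).summable]
  exact ENNReal.ofReal_lt_top

lemma integrable_diagMeasure (hE : IsProjectionResolution E) (a : ι → ℝ) (x : H) {f : ℝ → ℝ}
    (hf : Measurable f) {C : ℝ} (hC : ∀ t, |f t| ≤ C) : Integrable f (diagMeasure E a x) :=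
  have := hE.isFiniteMeasure_diagMeasure a x
  .of_bound hf.aestronglyMeasurable C (.of_forall hC)

lemma inner_eq_integral_diagMeasure (hE : IsProjectionResolution E) {a : ι → ℝ} (x : H)
    {f : ℝ → ℝ} (hf : Measurable f) {C : ℝ} (hC : ∀ t, |f t| ≤ C) {B : H →L[ℂ] H}
    (hB : ∀ i, B * E i = f (a i) • E i) :
    ⟪x, B x⟫_ℂ = ((∫ t, f t ∂(diagMeasure E a x) : ℝ) : ℂ) := by
  have h1 : HasSum (fun i => ‖E i x‖ ^ 2 * f (a i)) (∫ t, f t ∂(diagMeasure E a x)) := by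
    have := hasSum_integral_measure (hE.integrable_diagMeasure a x hf hC)
    simpa [integral_smul_measure, diagMeasure] using this
  refine (((hE.hasSum x).mapL B).mapL (innerSL ℂ x)).unique ?_
  have h2 : ∀ i, innerSL ℂ x (B (E i x)) = ((‖E i x‖ ^ 2 * f (a i) : ℝ) : ℂ) := fun i => by
    have : B (E i x) = (f (a i) : ℂ) • E i x := by
      simpa using congr($(hB i) x)
    rw [innerSL_apply_apply, this, inner_smul_right, hE.inner_apply_eq, Complex.ofReal_mul,
      mul_comm]
  simpa only [h2] using Complex.hasSum_ofReal.2 h1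

/-- If `A` has the eigenprojections `E i` with eigenvalues `a i`, then `f(A)` is the operator with
the same eigenprojections and the eigenvalues `f (a i)`. -/
lemma isBorelFunctionOf (hE : IsProjectionResolution E) {a : ι → ℝ} {A B : H →L[ℂ] H}
    (hA : IsSelfAdjoint A) (hAE : ∀ i, A * E i = a i • E i) {f : ℝ → ℝ} (hf : Measurable f)
    {C : ℝ} (hC : ∀ t, |f t| ≤ C) (hB : ∀ i, B * E i = f (a i) • E i) :
    IsBorelFunctionOf A f B := fun x => by
  refine ⟨diagMeasure E a x, ⟨hE.isFiniteMeasure_diagMeasure a x, fun g => ?_⟩,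
    hE.integrable_diagMeasure a x hf hC, hE.inner_eq_integral_diagMeasure x hf hC hB⟩
  refine hE.inner_eq_integral_diagMeasure x g.continuous.measurable (C := ‖g‖)
    (fun t => g.norm_coe_le_norm t) fun i => ?_
  ext y
  exact cfc_apply_of_apply_eq_smul hA g.continuous congr($(hAE i) y)

end IsProjectionResolution

end Diagonal

/-! ### Valuations of projections -/

section Completion

variable {H : Type*} [NormedAddCommGroup H] [InnerProductSpace ℂ H] [CompleteSpace H]

lemma IsProjectionResolution.option {ι : Type*} [Fintype ι] {F : ι → H →L[ℂ] H}
    (hF : ∀ i, IsStarProjection (F i)) (horth : ∀ i j, i ≠ j → F i * F j = 0) :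
    IsProjectionResolution fun o : Option ι => o.elim (1 - ∑ i, F i) F := by
  classical
  have hl : ∀ i, F i * ∑ j, F j = F i := fun i => by
    rw [Finset.mul_sum, Finset.sum_eq_single i (fun j _ hj => horth i j hj.symm) (by simp),
      (hF i).isIdempotentElem.eq]
  have hr : ∀ i, (∑ j, F j) * F i = F i := fun i => by
    rw [Finset.sum_mul, Finset.sum_eq_single i (fun j _ hj => horth j i hj) (by simp),
      (hF i).isIdempotentElem.eq]
  have hS : IsStarProjection (∑ i, F i) := by
    refine ⟨?_, ?_⟩
    · rw [IsIdempotentElem, Finset.sum_mul]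
      simp only [hl]
    · rw [IsSelfAdjoint, star_sum]
      exact Finset.sum_congr rfl fun i _ => (hF i).isSelfAdjoint.star_eq
  refine ⟨?_, ?_, fun x => ?_⟩
  · rintro (_ | i)
    exacts [hS.one_sub, hF i]
  · rintro (_ | i) (_ | j) hij
    · exact absurd rfl hij
    · simp [sub_mul, hr]
    · simp [mul_sub, hl]
    · exact horth i j fun h => hij (h ▸ rfl)
  · convert hasSum_fintype (fun o : Option ι => (o.elim (1 - ∑ i, F i) F : H →L[ℂ] H) x) using 1
    simp [Fintype.sum_option]

end Completion

namespace VonNeumannAlgebra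

variable {H : Type*} [NormedAddCommGroup H] [InnerProductSpace ℂ H] [CompleteSpace H]
  {R : VonNeumannAlgebra H} {ι : Type*}

lemma real_smul_mem (c : ℝ) {A : H →L[ℂ] H} (hA : A ∈ R) : c • A ∈ R := by
  have : c • A = (c : ℂ) • A := by ext; simp
  rw [this]
  exact R.toStarSubalgebra.smul_mem hA _

lemma mem_of_hasSum {F : ι → H →L[ℂ] H} {A : H →L[ℂ] H} (hF : ∀ i, F i ∈ R) (h : HasSum F A) :
    A ∈ R := by
  rw [← R.commutant_commutant, mem_commutant_iff]
  intro T hT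
  refine (h.mul_left T).unique ?_
  have : (fun i => T * F i) = fun i => F i * T :=
    funext fun i => ((mem_commutant_iff.1 hT) (F i) (hF i)).symm
  rw [this]
  exact h.mul_right T

/-- The proposition `T`, a projection of `R`, has the truth value `1` under the valuation `v`. -/
def IsTrue (v : R.selfAdjointPart → ℝ) (T : H →L[ℂ] H) : Prop :=
  ∃ h : T ∈ R.selfAdjointPart, v ⟨T, h⟩ = 1

/-- Distinct eigenvalues make the projections `E i` Borel functions of one operator
`A = ∑ aᵢ E i`. The value of `A` is some `aᵢ`, because the indicator of the remaining reals gives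
the operator `0`; then `E i` is the only true projection. -/
theorem IsValuationFunction.existsUnique_isTrue {v : R.selfAdjointPart → ℝ}
    (hv : R.IsValuationFunction v) [Countable ι] {E : ι → H →L[ℂ] H}
    (hE : IsProjectionResolution E) (hER : ∀ i, E i ∈ R) : ∃! i, IsTrue v (E i) := by
  classical
  obtain ⟨e, he⟩ := exists_injective_nat ι
  set a : ι → ℝ := fun i => (1 / 2) ^ e i with ha
  have ha_inj : Function.Injective a := fun i j hij =>
    he (pow_right_injective₀ (by norm_num) (by norm_num) hij)
  have hsum : Summable fun i => a i • E i := by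
    refine .of_norm_bounded (g := a) (summable_geometric_two.comp_injective he) fun i => ?_
    rw [norm_smul, Real.norm_of_nonneg (by positivity)]
    exact mul_le_of_le_one_right (by positivity) (hE.isStarProjection i).norm_le
  obtain ⟨A, hA⟩ := hsum
  have hAR : A ∈ R := mem_of_hasSum (fun i => real_smul_mem _ (hER i)) hA
  have hAs : IsSelfAdjoint A := by
    refine HasSum.unique ?_ hA
    simpa [(hE.isStarProjection _).isSelfAdjoint.star_eq] using hA.star
  have hAE : ∀ j, A * E j = a j • E j := fun j => by
    have : ∀ i, a i • E i * E j = if i = j then a j • E j else 0 := fun i => by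
      split_ifs with h
      · rw [h, smul_mul_assoc, (hE.isStarProjection j).isIdempotentElem.eq]
      · rw [smul_mul_assoc, hE.mul_eq_zero i j h, smul_zero]
    refine (hA.mul_right (E j)).unique ?_
    simp only [this]
    exact hasSum_ite_eq j (a j • E j)
  have hbound : ∀ (s : Set ℝ) t, |s.indicator (1 : ℝ → ℝ) t| ≤ 1 := fun s t => by
    by_cases h : t ∈ s <;> simp [h]
  have hEs : ∀ i, E i ∈ R.selfAdjointPart := fun i =>
    ⟨hER i, (hE.isStarProjection i).isSelfAdjoint⟩
  obtain ⟨i, hi⟩ : v ⟨A, hAR, hAs⟩ ∈ Set.range a := by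
    have hms : MeasurableSet (Set.range a)ᶜ := (Set.countable_range a).measurableSet.compl
    have h0 := hv.func ⟨A, hAR, hAs⟩ ⟨0, zero_mem R, .zero _⟩ ((Set.range a)ᶜ.indicator 1)
      (measurable_one.indicator hms)
      (hE.isBorelFunctionOf hAs hAE (measurable_one.indicator hms) (hbound _) fun i => by simp)
    have h1 : v ⟨0, zero_mem R, .zero _⟩ = 0 := by
      have := hv.mem_spectrum ⟨0, zero_mem R, .zero _⟩
      have := spectrum.norm_le_norm_mul_of_mem this
      simpa using this
    by_contra hn
    rw [h1, Set.indicator_of_mem hn] at h0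
    simp at h0
  have hval : ∀ j, v ⟨E j, hEs j⟩ = ({a j} : Set ℝ).indicator 1 (a i) := fun j => by
    rw [hi]
    have hms : MeasurableSet ({a j} : Set ℝ) := measurableSet_singleton _
    refine hv.func _ _ _ (measurable_one.indicator hms)
      (hE.isBorelFunctionOf hAs hAE (measurable_one.indicator hms) (hbound _) fun k => ?_)
    by_cases h : k = j
    · simp [h, (hE.isStarProjection j).isIdempotentElem.eq]
    · simp [ha_inj.eq_iff, h, hE.mul_eq_zero j k (Ne.symm h)]
  refine ⟨i, ⟨hEs i, by simp [hval]⟩, fun j ⟨_, hj⟩ => ?_⟩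
  rw [hval] at hj
  by_contra h
  simp [ha_inj.eq_iff, Ne.symm h] at hj

lemma IsValuationFunction.existsUnique_isTrue_option {v : R.selfAdjointPart → ℝ}
    (hv : R.IsValuationFunction v) [Fintype ι] {F : ι → H →L[ℂ] H} (hFR : ∀ i, F i ∈ R)
    (hF : ∀ i, IsStarProjection (F i)) (horth : ∀ i j, i ≠ j → F i * F j = 0) :
    ∃! o : Option ι, IsTrue v (o.elim (1 - ∑ i, F i) F) := by
  refine hv.existsUnique_isTrue (.option hF horth) ?_
  rintro (_ | i)
  exacts [sub_mem (one_mem R) (sum_mem fun i _ => hFR i), hFR i]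

lemma IsValuationFunction.not_isTrue_of_mul_eq_zero {v : R.selfAdjointPart → ℝ}
    (hv : R.IsValuationFunction v) {P Q : H →L[ℂ] H} (hP : IsStarProjection P)
    (hQ : IsStarProjection Q) (hPQ : P * Q = 0) (h : IsTrue v P) : ¬ IsTrue v Q := fun h' => by
  have hQP : Q * P = 0 := by
    simpa [hP.isSelfAdjoint.star_eq, hQ.isSelfAdjoint.star_eq] using congr(star $hPQ)
  have := hv.existsUnique_isTrue_option (F := ![P, Q]) (by simp [Fin.forall_fin_two, h.1.1, h'.1.1])
    (by simp [Fin.forall_fin_two, hP, hQ]) (by simp [Fin.forall_fin_two, hPQ, hQP])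
  have := this.unique (y₁ := some 0) (y₂ := some 1) h h'
  simp at this

/-- The valuation is additive: if two orthogonal families have the same sum and one of them
contains a true projection, then so does the other, as neither complement is true. -/
lemma IsValuationFunction.exists_isTrue_of_sum_eq {v : R.selfAdjointPart → ℝ}
    (hv : R.IsValuationFunction v) {κ : Type*} [Fintype ι] [Fintype κ]
    {F : ι → H →L[ℂ] H} {G : κ → H →L[ℂ] H} (hFR : ∀ i, F i ∈ R) (hGR : ∀ i, G i ∈ R)
    (hF : ∀ i, IsStarProjection (F i)) (hG : ∀ i, IsStarProjection (G i))
    (hFo : ∀ i j, i ≠ j → F i * F j = 0) (hGo : ∀ i j, i ≠ j → G i * G j = 0)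
    (hsum : ∑ i, F i = ∑ i, G i) {i : ι} (hi : IsTrue v (F i)) : ∃ k, IsTrue v (G k) := by
  obtain ⟨_ | k, hk, -⟩ := hv.existsUnique_isTrue_option hGR hG hGo
  · have := (hv.existsUnique_isTrue_option hFR hF hFo).unique (y₁ := some i) (y₂ := none) hi
      (by simpa [hsum] using hk)
    simp at this
  · exact ⟨k, hk⟩

end VonNeumannAlgebra

/-! ### Matrix units and projections onto lines -/

section MatrixUnits

open Matrix

variable {A : Type*} [Ring A] [StarRing A] [Algebra ℝ A]

/-- The element `∑ Mᵢⱼ Vᵢ Vⱼ*`. If the `Vᵢ` are partial isometries with a common initial projection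
and orthogonal ranges, the `Vᵢ Vⱼ*` are matrix units. -/
def matrixUnitSum (V : Fin 3 → A) (M : Matrix (Fin 3) (Fin 3) ℝ) : A :=
  ∑ i, ∑ j, M i j • (V i * star (V j))

variable {V : Fin 3 → A} {e : A}

lemma matrixUnitSum_mul (hV : ∀ i j, star (V i) * V j = if i = j then e else 0)
    (he : ∀ i, V i * e = V i) (M N : Matrix (Fin 3) (Fin 3) ℝ) :
    matrixUnitSum V M * matrixUnitSum V N = matrixUnitSum V (M * N) := by
  have key : ∀ i j k l, V i * star (V j) * (V k * star (V l)) =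
      if j = k then V i * star (V l) else 0 := fun i j k l => by
    rw [mul_assoc, ← mul_assoc (star (V j)), hV]
    split_ifs
    · rw [← mul_assoc, he]
    · simp
  simp only [matrixUnitSum, Finset.sum_mul, Finset.mul_sum, smul_mul_smul_comm,
    key, smul_ite, smul_zero, Matrix.mul_apply, Finset.sum_smul]
  simp [Fin.sum_univ_three]
  abel

lemma star_matrixUnitSum [StarModule ℝ A] (M : Matrix (Fin 3) (Fin 3) ℝ) :
    star (matrixUnitSum V M) = matrixUnitSum V Mᵀ := by
  simp only [matrixUnitSum, star_sum, star_smul, star_mul, star_star, star_trivial,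
    Matrix.transpose_apply]
  exact Finset.sum_comm

lemma matrixUnitSum_one : matrixUnitSum V 1 = ∑ i, V i * star (V i) := by
  simp [matrixUnitSum, Matrix.one_apply]

lemma matrixUnitSum_zero : matrixUnitSum V 0 = 0 := by
  simp [matrixUnitSum]

lemma matrixUnitSum_add (M N : Matrix (Fin 3) (Fin 3) ℝ) :
    matrixUnitSum V (M + N) = matrixUnitSum V M + matrixUnitSum V N := by
  simp [matrixUnitSum, add_smul, Finset.sum_add_distrib]

/-- The matrix of the orthogonal projection of `ℝ³` onto the line through `u ≠ 0`. -/
noncomputable def lineProj (u : Fin 3 → ℝ) : Matrix (Fin 3) (Fin 3) ℝ :=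
  (u ⬝ᵥ u)⁻¹ • vecMulVec u u

lemma lineProj_transpose (u : Fin 3 → ℝ) : (lineProj u)ᵀ = lineProj u := by
  simp [lineProj, Matrix.transpose_smul, Matrix.transpose_vecMulVec]

lemma lineProj_mul_self {u : Fin 3 → ℝ} (hu : u ≠ 0) : lineProj u * lineProj u = lineProj u := by
  have : u ⬝ᵥ u ≠ 0 := by simpa using hu
  simp [lineProj, Matrix.vecMulVec_mul_vecMulVec, smul_smul, this]

lemma lineProj_mul {u w : Fin 3 → ℝ} (h : u ⬝ᵥ w = 0) : lineProj u * lineProj w = 0 := by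
  simp [lineProj, Matrix.vecMulVec_mul_vecMulVec, h]

lemma lineProj_add_add {u v w : Fin 3 → ℝ} (hu : u ≠ 0) (hv : v ≠ 0) (hw : w ≠ 0)
    (huv : u ⬝ᵥ v = 0) (huw : u ⬝ᵥ w = 0) (hvw : v ⬝ᵥ w = 0) :
    lineProj u + lineProj v + lineProj w = 1 := by
  -- With `M` the matrix of rows `u, v, w` and `N` that of the rescaled columns, the claim is
  -- `N * M = 1`, whereas orthogonality says `M * N = 1`.
  let M : Matrix (Fin 3) (Fin 3) ℝ := .of ![u, v, w]
  let N : Matrix (Fin 3) (Fin 3) ℝ :=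
    (Matrix.of ![(u ⬝ᵥ u)⁻¹ • u, (v ⬝ᵥ v)⁻¹ • v, (w ⬝ᵥ w)⁻¹ • w])ᵀ
  have hu' : u ⬝ᵥ u ≠ 0 := by simpa using hu
  have hv' : v ⬝ᵥ v ≠ 0 := by simpa using hv
  have hw' : w ⬝ᵥ w ≠ 0 := by simpa using hw
  have hMN : M * N = 1 := by
    have : ∀ i j, (M * N) i j = ![u, v, w] i ⬝ᵥ
        ![(u ⬝ᵥ u)⁻¹ • u, (v ⬝ᵥ v)⁻¹ • v, (w ⬝ᵥ w)⁻¹ • w] j := fun i j => rfl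
    ext i j
    rw [this]
    fin_cases i <;> fin_cases j <;>
      simp [hu', hv', hw', huv, huw, hvw, dotProduct_comm v u, dotProduct_comm w u,
        dotProduct_comm w v]
  rw [← mul_eq_one_comm.1 hMN]
  ext i j
  simp [M, N, Matrix.mul_apply, Fin.sum_univ_three, lineProj, vecMulVec_apply]
  ring

end MatrixUnits

/-! ### Reduction to the Kochen–Specker theorem -/

section Projections

variable {H : Type*} [NormedAddCommGroup H] [InnerProductSpace ℂ H]

/-- `V` is a partial isometry if `V* V` is a projection: `(V V* V - V)* (V V* V - V) = 0`. -/
lemma mul_star_mul_self_of_isStarProjection [CompleteSpace H] {V : H →L[ℂ] H}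
    (h : IsStarProjection (star V * V)) :
    V * (star V * V) = V := by
  set E := star V * V with hE
  have h0 : star (V * E - V) * (V * E - V) = 0 := by
    have h1 : star (V * E - V) * (V * E - V) = star E * E * E - star E * E - E * E + E := by
      rw [hE]; simp only [star_sub, star_mul, star_star]; noncomm_ring
    rw [h1, h.isSelfAdjoint.star_eq, h.isIdempotentElem.eq, h.isIdempotentElem.eq]
    abel
  exact sub_eq_zero.1 ((CStarRing.star_mul_self_eq_zero_iff _).1 h0)

/-- For `x` in a countable dense set, only countably many terms `E x` are nonzero, and each `E ≠ 0`
is nonzero at such an `x`. -/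
lemma countable_of_hasSum_apply [TopologicalSpace.SeparableSpace H]
    {P : Set (H →L[ℂ] H)} (hP : ∀ x : H, HasSum (fun E : P => (E : H →L[ℂ] H) x) x) :
    P.Countable := by
  obtain ⟨D, hD, hDd⟩ := TopologicalSpace.exists_countable_dense H
  have hsub : P ⊆ insert 0 (⋃ x ∈ D,
      Subtype.val '' (Function.support fun E : P => (E : H →L[ℂ] H) x)) := fun E hE => by
    by_cases h0 : E = 0
    · exact .inl h0
    · obtain ⟨x, hxD, hx⟩ : ∃ x ∈ D, E x ≠ 0 := by
        by_contra! hn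
        refine h0 (ContinuousLinearMap.coeFn_injective ?_)
        exact E.continuous.ext_on hDd continuous_const fun x hx => hn x hx
      exact .inr (Set.mem_biUnion hxD ⟨⟨E, hE⟩, hx, rfl⟩)
  refine Set.Countable.mono hsub (.insert _ (hD.biUnion fun x _ => .image ?_ _))
  exact (hP x).summable.countable_support

end Projections

theorem mainTheorem2 {H : Type*} [NormedAddCommGroup H] [InnerProductSpace ℂ H] [CompleteSpace H]
    (R : VonNeumannAlgebra H) (n : ℕ∞) (hn : 3 ≤ n)
    (hsep : n = ⊤ → TopologicalSpace.SeparableSpace H)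
    (hfactor : R.IsFactor) (htype : R.IsTypeI n) :
    ¬ ∃ v : R.selfAdjointPart → ℝ, R.IsValuationFunction v := by
  rintro ⟨v, hv⟩
  obtain ⟨P, hPn, hPab, hPo, hPe, hPs⟩ := htype
  have hPc : P.Countable := by
    by_cases h : n = ⊤
    · have := hsep h
      exact countable_of_hasSum_apply hPs
    · exact (Set.encard_ne_top_iff.1 (hPn ▸ h)).countable
  have := hPc.to_subtype
  obtain ⟨⟨E₀, hE₀⟩, hE₀t, -⟩ := hv.existsUnique_isTrue (E := fun E : P => (E : H →L[ℂ] H))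
    ⟨fun E => (hPab E E.2).2.1, fun E F h => hPo E E.2 F F.2 (Subtype.coe_injective.ne h), hPs⟩
    fun E => (hPab E E.2).1
  obtain ⟨E₁, E₂, ⟨hE₁, h10⟩, ⟨hE₂, h20⟩, h12⟩ :
      ∃ E₁ E₂, E₁ ∈ P \ {E₀} ∧ E₂ ∈ P \ {E₀} ∧ E₁ ≠ E₂ := by
    rw [← Set.one_lt_encard_iff]
    have := Set.encard_sdiff_singleton_add_one hE₀
    rw [hPn] at this
    by_contra! hle
    have : n ≤ 1 + 1 := this ▸ add_le_add_left hle 1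
    exact absurd (hn.trans this) (by decide)
  rw [Set.mem_singleton_iff] at h10 h20
  -- The matrix units `Vᵢ Vⱼ*` turn the projections onto lines of `ℝ³` into projections of `R` below
  -- the true projection `E₀ + E₁ + E₂`.
  let E : Fin 3 → H →L[ℂ] H := ![E₀, E₁, E₂]
  have hEP : ∀ i, E i ∈ P := by simp [E, Fin.forall_fin_succ, hE₀, hE₁, hE₂]
  have hEi : Function.Injective E := by
    intro i j h
    fin_cases i <;> fin_cases j <;> simp_all [E, eq_comm]
  have hEo : ∀ i j, i ≠ j → E i * E j = 0 := fun i j h =>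
    hPo _ (hEP i) _ (hEP j) (hEi.ne h)
  have hEp : ∀ i, IsStarProjection (E i) := fun i => (hPab _ (hEP i)).2.1
  choose V hVR hV₁ hV₂ using fun i => hPe E₀ hE₀ (E i) (hEP i)
  have hVe : ∀ i, V i * E₀ = V i := fun i => by
    rw [← hV₁ i]
    exact mul_star_mul_self_of_isStarProjection (hV₁ i ▸ (hPab _ hE₀).2.1)
  have hEV : ∀ i, E i * V i = V i := fun i => by
    rw [← hV₂ i, mul_assoc, hV₁, hVe]
  have hVV : ∀ i j, star (V i) * V j = if i = j then E₀ else 0 := fun i j => by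
    split_ifs with h
    · rw [← h, hV₁]
    · rw [← hEV i, ← hEV j, star_mul, (hEp i).isSelfAdjoint.star_eq, mul_assoc,
        ← mul_assoc (E i), hEo i j h, zero_mul, mul_zero]
  have hφR : ∀ M, matrixUnitSum V M ∈ R := fun M =>
    sum_mem fun i _ => sum_mem fun j _ => VonNeumannAlgebra.real_smul_mem _
      (mul_mem (hVR i) (star_mem (hVR j)))
  have hφ := fun M N => matrixUnitSum_mul hVV hVe M N
  have hproj : ∀ u, u ≠ 0 → IsStarProjection (matrixUnitSum V (lineProj u)) := fun u hu =>
    ⟨by rw [IsIdempotentElem, hφ, lineProj_mul_self hu],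
      by rw [IsSelfAdjoint, star_matrixUnitSum, lineProj_transpose]⟩
  have hzero : ∀ u w, u ⬝ᵥ w = 0 →
      matrixUnitSum V (lineProj u) * matrixUnitSum V (lineProj w) = 0 := fun u w h => by
    rw [hφ, lineProj_mul h, matrixUnitSum_zero]
  refine not_isFrameColoring
    (fun u => VonNeumannAlgebra.IsTrue v (matrixUnitSum V (lineProj u))) ⟨?_, ?_⟩
  · exact fun u w hu hw h => hv.not_isTrue_of_mul_eq_zero (hproj u hu) (hproj w hw) (hzero u w h)
  · intro x y z hx hy hz hxy hxz hyz
    obtain ⟨k, hk⟩ := hv.exists_isTrue_of_sum_eq (F := E)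
      (G := fun k => matrixUnitSum V (lineProj (![x, y, z] k)))
      (fun i => (hPab _ (hEP i)).1) (fun _ => hφR _) hEp
      (fun k => hproj _ (by fin_cases k <;> assumption)) hEo
      (fun i j hij => hzero _ _ (by
        fin_cases i <;> fin_cases j <;>
          simp_all [dotProduct_comm y x, dotProduct_comm z x, dotProduct_comm z y]))
      (by
        rw [Fin.sum_univ_three (fun k => matrixUnitSum V (lineProj (![x, y, z] k))),
          ← matrixUnitSum_add, ← matrixUnitSum_add]
        change _ = matrixUnitSum V (lineProj x + lineProj y + lineProj z)
        rw [lineProj_add_add hx hy hz hxy hxz hyz, matrixUnitSum_one]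
        simp only [hV₂])
      (i := 0) hE₀t
    fin_cases k
    exacts [.inl hk, .inr (.inl hk), .inr (.inr hk)]
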